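/- **Open online dial-a-ride on the line.** A server of capacity $c\in\{1,2,\dots\}\cup\{\infty\}$ starts at time $0$ in the origin of $\mathbb{R}$ and moves with speed at most $1$. Requests $r_i=(a_i,b_i;t_i)$, $i=1,\dots,n$ ($n\ge 1$), with $0<t_1<\dots<t_n$ are revealed at their release times $t_i$; each has to be loaded at $a_i$ not before time $t_i$ and carried to $b_i$, without being unloaded elsewhere, while at most $c$ requests are on board at any time. The server need not return to the origin. The completion time is the time at which all requests have been served; $\mathrm{Opt}(\sigma)$ is the optimal offline completion time for the request sequence $\sigma$, and $\mathrm{Opt}(t)$ the one for the requests released not later than $t$. The (strict) competitive ratio of an online algorithm $\mathrm{Alg}$ is $\sup_\sigma \mathrm{Alg}(\sigma)/\mathrm{Opt}(\sigma)$. **The algorithm $\mathrm{Lazy}(\alpha)$, $\alpha\ge 0$.** Whenever a request is released, at time $t$: if the server can deliver all loaded requests and be back in the origin by time $\alpha\cdot\mathrm{Opt}(t)$, it aborts its current command and does so in an optimal way; otherwise it continues its current command. Whenever the server is idle (it has completed its current command, or it has none and a request is released that does not make it return), at time $t$: if $t<\alpha\cdot\mathrm{Opt}(t)$, it waits at its position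 until time $\alpha\cdot\mathrm{Opt}(t)$; otherwise, if the set $R_t$ of released, unserved requests is non-empty, it follows a shortest schedule that starts at its current position and serves all requests in $R_t$. Ties between optimal choices are broken by an arbitrary deterministic online rule. **Corollary 1.** For every $\alpha\ge 0$, every capacity $c\in\{1,2,\dots\}\cup\{\infty\}$ and every tie-breaking rule, $\mathrm{Lazy}(\alpha)$ has competitive ratio at least $$\frac32+\sqrt{\frac{11}{12}}\approx 2.457$$ for open online dial-a-ride on the line. More precisely, its competitive ratio is at least $\max\{1+\alpha,\,2+\frac{2}{3\alpha}\}$ if $\alpha\ge 1$, and at least $1+\frac{3}{\alpha+1}$ if $0\le\alpha<1$. -/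

import Mathlib

open scoped ENNReal

namespace DialARide

/-- A transportation request on the real line: it appears at time `release`, has to be loaded at
`src` not earlier than that, and has to be unloaded at `dst`. -/
structure Request where
  src : ℝ
  dst : ℝ
  release : ℝ

/-- Request sequences `r₁, …, rₙ` (`n ≥ 1`) with release times `0 < t₁ < … < tₙ`. -/
def IsRequestSequence (σ : List Request) : Prop :=
  σ ≠ [] ∧ (∀ r ∈ σ, 0 < r.release) ∧ σ.Pairwise (fun r r' => r.release < r'.release)

/-- A plan of the server, in absolute time: its position at every time, the times at which it
loads and unloads requests, and the time at which the plan is completed. -/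
structure Schedule where
  pos : ℝ → ℝ
  load : Request → ℝ
  unload : Request → ℝ
  finish : ℝ

/-- From time `t₀` on, when it is in `x`, the server moves with speed at most one. -/
def Schedule.MovesFrom (s : Schedule) (x t₀ : ℝ) : Prop :=
  s.pos t₀ = x ∧ ∀ t t' : ℝ, t₀ ≤ t → t₀ ≤ t' → |s.pos t - s.pos t'| ≤ |t - t'|

open Classical in
/-- The server, with capacity `c`, never carries too many of the requests in `R`.
Several loadings and unloadings may happen at one time in a suitable order: requests that are due
are unloaded first. The first clause says that after all actions of time `t` at most `c` requests
are on board. The second one says that there is a free place for each `r` at the time when it is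
loaded, even if `r` is unloaded at that very time (as may happen when its source and destination
coincide). -/
def Schedule.RespectsCapacity (s : Schedule) (c : ℕ∞) (R : Finset Request) : Prop :=
  (∀ t : ℝ, ((R.filter (fun r => s.load r ≤ t ∧ t < s.unload r)).card : ℕ∞) ≤ c) ∧
  (∀ r ∈ R,
    ((R.filter (fun r' => s.load r' < s.load r ∧ s.load r < s.unload r')).card : ℕ∞) < c)

/-- `s` is a (non-preemptive) schedule for an empty server of capacity `c` that starts at time `t₀`
in `x` and has served all requests in `R` by time `s.finish`. -/
def Schedule.Serves (s : Schedule) (c : ℕ∞) (R : Finset Request) (x t₀ : ℝ) : Prop :=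
  s.MovesFrom x t₀ ∧ t₀ ≤ s.finish ∧
  (∀ r ∈ R, t₀ ≤ s.load r ∧ r.release ≤ s.load r ∧ s.pos (s.load r) = r.src ∧
    s.load r ≤ s.unload r ∧ s.pos (s.unload r) = r.dst ∧ s.unload r ≤ s.finish) ∧
  s.RespectsCapacity c R

/-- `s` is a shortest schedule `S(R, x)`, started at time `t₀`. -/
def Schedule.IsShortest (s : Schedule) (c : ℕ∞) (R : Finset Request) (x t₀ : ℝ) : Prop :=
  s.Serves c R x t₀ ∧ ∀ s' : Schedule, s'.Serves c R x t₀ → s.finish ≤ s'.finish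

/-- Starting at time `t₀` in `x` with the requests in `L` on board, `s` delivers all of them and is
back in the origin at time `s.finish`. -/
def Schedule.Returns (s : Schedule) (L : Finset Request) (x t₀ : ℝ) : Prop :=
  s.MovesFrom x t₀ ∧ t₀ ≤ s.finish ∧
  (∀ r ∈ L, t₀ ≤ s.unload r ∧ s.pos (s.unload r) = r.dst ∧ s.unload r ≤ s.finish) ∧
  s.pos s.finish = 0

/-- `s` delivers the requests in `L` and returns to the origin in an optimal way. -/
def Schedule.IsShortestReturn (s : Schedule) (L : Finset Request) (x t₀ : ℝ) : Prop :=
  s.Returns L x t₀ ∧ ∀ s' : Schedule, s'.Returns L x t₀ → s.finish ≤ s'.finish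

/-- The completion time of the offline optimum for the requests in `R`: the server starts at time
`0` in the origin, knows all requests, and does not have to return. -/
noncomputable def opt (c : ℕ∞) (R : Finset Request) : ℝ :=
  sInf {T : ℝ | ∃ s : Schedule, s.Serves c R 0 0 ∧ s.finish = T}

/-- A deterministic online rule that selects one of the shortest schedules, and one of the optimal
ways to deliver and return. Besides the set of requests, the position and the current time, the
choice may depend on the list of all requests released so far. -/
structure TieBreaking (c : ℕ∞) where
  follow : List Request → Finset Request → ℝ → ℝ → Schedule
  follow_spec : ∀ (h : List Request) (R : Finset Request) (x t₀ : ℝ),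
    (∃ s : Schedule, s.IsShortest c R x t₀) → (follow h R x t₀).IsShortest c R x t₀
  ret : List Request → Finset Request → ℝ → ℝ → Schedule
  ret_spec : ∀ (h : List Request) (L : Finset Request) (x t₀ : ℝ),
    (∃ s : Schedule, s.IsShortestReturn L x t₀) → (ret h L x t₀).IsShortestReturn L x t₀

theorem TieBreaking.nonempty (c : ℕ∞) : Nonempty (TieBreaking c) := by
  classical
  exact ⟨{
    follow := fun _ R x t₀ => Classical.epsilon (h := ⟨⟨0, 0, 0, 0⟩⟩) (fun s => s.IsShortest c R x t₀)
    follow_spec := fun _ _ _ _ h => Classical.epsilon_spec_aux _ _ h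
    ret := fun _ L x t₀ => Classical.epsilon (h := ⟨⟨0, 0, 0, 0⟩⟩) (fun s => s.IsShortestReturn L x t₀)
    ret_spec := fun _ _ _ _ h => Classical.epsilon_spec_aux _ _ h }⟩

/-- What the server is currently doing. -/
inductive Command where
  /-- nothing; the server stays where it is -/
  | idle
  /-- `wait_until T` -/
  | wait (T : ℝ)
  /-- `deliver_and_return`, carried out as `s` -/
  | ret (s : Schedule)
  /-- `follow_schedule s`, where `s` serves the requests in `R` -/
  | follow (R : Finset Request) (s : Schedule)

/-- The time at which the execution of a command is completed. -/
def Command.finish? : Command → Option ℝ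
  | .idle => none
  | .wait T => some T
  | .ret s => some s.finish
  | .follow _ s => some s.finish

/-- A configuration of the simulation. The algorithm itself never looks at `future`. -/
structure Config where
  /-- current time `t` -/
  time : ℝ
  /-- current position of the server -/
  pos : ℝ
  /-- requests on board -/
  loaded : Finset Request
  /-- released requests that have not been loaded yet -/
  pending : Finset Request
  cmd : Command
  /-- all requests released so far, latest first -/
  released : List Request
  /-- requests that are still to be released, in the order of their release times -/
  future : List Request

/-- At time `0` the empty server stays in the origin and no request has been released. -/
def Config.init (σ : List Request) : Config where
  time := 0
  pos := 0
  loaded := ∅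
  pending := ∅
  cmd := .idle
  released := []
  future := σ

open Classical in
/-- Execute the current command up to time `τ`. -/
noncomputable def Config.advance (C : Config) (τ : ℝ) : Config :=
  match C.cmd with
  | .idle => { C with time := τ }
  | .wait _ => { C with time := τ }
  | .ret s =>
    { C with
      time := τ
      pos := s.pos τ
      loaded := C.loaded.filter (fun r => τ < s.unload r) }
  | .follow R s =>
    { C with
      time := τ
      pos := s.pos τ
      loaded := R.filter (fun r => s.load r ≤ τ ∧ τ < s.unload r)
      pending := C.pending.filter (fun r => ¬ (r ∈ R ∧ s.load r ≤ τ)) }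

open Classical in
/-- `Opt(t)` for the current time `t`. -/
noncomputable def Config.opt (c : ℕ∞) (C : Config) : ℝ :=
  DialARide.opt c C.released.toFinset

open Classical in
/-- The part "upon becoming idle" of `Lazy(α)`. -/
noncomputable def Config.whenIdle {c : ℕ∞} (tb : TieBreaking c) (α : ℝ) (C : Config) : Config :=
  if C.time < α * C.opt c then
    { C with cmd := .wait (α * C.opt c) }
  else if C.pending ≠ ∅ then
    { C with cmd := .follow C.pending (tb.follow C.released C.pending C.pos C.time) }
  else
    { C with cmd := .idle }

/-- The current command has been completed at time `e`. -/
noncomputable def Config.complete {c : ℕ∞} (tb : TieBreaking c) (α : ℝ) (C : Config) (e : ℝ) :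
    Config :=
  Config.whenIdle tb α { C.advance e with cmd := .idle }

open Classical in
/-- The execution of the current command up to the release of `r`, when `r` is registered. -/
noncomputable def Config.register (C : Config) (r : Request) (rest : List Request) : Config :=
  { C.advance r.release with
    pending := insert r (C.advance r.release).pending
    released := r :: C.released
    future := rest }

open Classical in
/-- The part "upon receiving request" of `Lazy(α)`, for a configuration in which the new request
has just been registered. If the current command is not replaced by `deliver_and_return`, it is
continued; a server that has no current command is idle and acts accordingly. -/
noncomputable def Config.uponRequest {c : ℕ∞} (tb : TieBreaking c) (α : ℝ) (C : Config) : Config :=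
  if ∃ s : Schedule, s.Returns C.loaded C.pos C.time ∧ s.finish ≤ α * C.opt c then
    { C with cmd := .ret (tb.ret C.released C.loaded C.pos C.time) }
  else
    match C.cmd with
    | .idle => C.whenIdle tb α
    | _ => C

open Classical in
/-- Go to the next event: the release of a request or the completion of the current command
(in this order, if they happen at the same time). -/
noncomputable def Config.step {c : ℕ∞} (tb : TieBreaking c) (α : ℝ) (C : Config) : Config :=
  match C.cmd.finish?, C.future with
  | none, [] => C
  | none, r :: rest => (C.register r rest).uponRequest tb α
  | some e, [] => C.complete tb α e
  | some e, r :: rest =>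
    if r.release ≤ e then (C.register r rest).uponRequest tb α else C.complete tb α e

/-- All requests have been released and served. -/
def Config.Done (C : Config) : Prop :=
  C.future = [] ∧ C.pending = ∅ ∧ C.loaded = ∅

/-- The completion time of `Lazy(α)` on `σ`: the first time at which all requests have been served
(`∞` if there is none). A shortest schedule is completed with the last delivery, so that it is
enough to look at the event times. -/
noncomputable def lazyTime {c : ℕ∞} (tb : TieBreaking c) (α : ℝ) (σ : List Request) : ℝ≥0∞ :=
  ⨅ (k : ℕ) (_ : ((Config.step tb α)^[k] (Config.init σ)).Done),
    ENNReal.ofReal ((Config.step tb α)^[k] (Config.init σ)).time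

open Classical in
/-- The strict competitive ratio `sup_σ Lazy(α)(σ) / Opt(σ)` on the line, for server capacity `c`
and tie-breaking rule `tb`. -/
noncomputable def lazyCompetitiveRatio {c : ℕ∞} (tb : TieBreaking c) (α : ℝ) : ℝ≥0∞ :=
  ⨆ (σ : List Request) (_ : IsRequestSequence σ),
    lazyTime tb α σ / ENNReal.ofReal (opt c σ.toFinset)

end DialARide

/-!
A request in `1` that appears right after time `0` can be served by time `1`, but `Lazy(α)` leaves
the origin only at time `α`. This gives `1 + α`.

For `α < 1`, early requests make the server leave the origin for `1` at time `α`, in such a way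
that the requests that appear as soon as it is on its way (one in the origin and a ride from just
beyond `1 / 2` to `1`) come too late for it to return by time `α * Opt`: for `α > 0` this is
because of the load it has to drop in `1 / 2` first. From `1` it is shortest to do the ride and to
end in the origin, at time `α + 3`, from where it must go back to `1` for a last request that has
appeared after it left that point. An offline server waits in the origin and sweeps to `1` by time
`α + 1`, up to an arbitrarily small perturbation.

For `α ≥ 1`, the server receives two symmetric rides to `1` and `-1` and serves them from time
`3 * α` to time `3 * α + 3`, ending in `-g`, say. As soon as it has loaded the ride to `g`, it can
no longer return by time `α * Opt`, and a last request appears in `g * (3 * α - 2)`. The server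
reaches it at time `6 * α + 2`, whereas an offline server that serves `-g` before `g` is there when
the request appears.
-/

open Filter Topology

namespace DialARide

/- The definitions above choose decidability classically; this instance unfolds to their choice. -/
noncomputable instance : DecidableEq Request := fun _ _ => Classical.propDecidable _

variable {c : ℕ∞} {α T : ℝ} {tb : TieBreaking c}

theorem ofReal_le_of_eventually_nhdsGT {f : ℝ → ℝ} {A : ℝ≥0∞} (hf : ContinuousAt f 0)
    (hle : ∀ᶠ δ in 𝓝[>] (0 : ℝ), ENNReal.ofReal (f δ) ≤ A) : ENNReal.ofReal (f 0) ≤ A :=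
  le_of_tendsto ((ENNReal.continuous_ofReal.tendsto _).comp
    (hf.tendsto.mono_left nhdsWithin_le_nhds)) hle

section Schedules

variable {s : Schedule} {R R' L : Finset Request} {r r' : Request} {x y t₀ t₁ t₂ t : ℝ}

theorem Schedule.MovesFrom.abs_sub_le (h : s.MovesFrom x t₀) (ht : t₀ ≤ t) :
    |s.pos t - x| ≤ t - t₀ := by
  simpa only [h.1, abs_of_nonneg (sub_nonneg.2 ht)] using h.2 t t₀ ht le_rfl

theorem Schedule.MovesFrom.abs_pos_sub_pos_le (h : s.MovesFrom x t₀) (ht₁ : t₀ ≤ t₁)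
    (ht : t₁ ≤ t) : |s.pos t - s.pos t₁| ≤ t - t₁ := by
  simpa only [abs_of_nonneg (sub_nonneg.2 ht)] using h.2 t t₁ (ht₁.trans ht) ht₁

/-- The motion at unit speed from `y`, left at time `t₁`, to `p`, where it ends. -/
noncomputable def travel (y t₁ p t : ℝ) : ℝ := max (y - (t - t₁)) (min p (y + (t - t₁)))

theorem travel_of_abs_le {p : ℝ} (h : |p - y| ≤ t - t₁) : travel y t₁ p t = p := by
  obtain ⟨h₁, h₂⟩ := abs_le.1 h
  rw [travel, min_eq_left (by linarith), max_eq_right (by linarith)]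

theorem travel_self (y t₁ p : ℝ) : travel y t₁ p t₁ = y := by
  simp [travel]

theorem abs_travel_sub_travel_le (y t₁ p t t' : ℝ) :
    |travel y t₁ p t - travel y t₁ p t'| ≤ |t - t'| := by
  refine (abs_max_sub_max_le_max _ _ _ _).trans (max_le (le_of_eq ?_)
    ((abs_min_sub_min_le_max _ _ _ _).trans (max_le (by simp) (le_of_eq ?_))))
  · rw [abs_sub_comm t]; ring_nf
  · ring_nf

/-- Carry out `s` until time `t₁` and then travel to `p`. -/
noncomputable def Schedule.thenTravel (s : Schedule) (t₁ p : ℝ) : Schedule :=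
  { s with pos := fun t => if t ≤ t₁ then s.pos t else travel (s.pos t₁) t₁ p t }

theorem Schedule.thenTravel_pos_of_le {p : ℝ} (ht : t ≤ t₁) :
    (s.thenTravel t₁ p).pos t = s.pos t :=
  if_pos ht

theorem Schedule.thenTravel_pos_of_ge {p : ℝ} (ht : t₁ ≤ t) :
    (s.thenTravel t₁ p).pos t = travel (s.pos t₁) t₁ p t := by
  rcases ht.eq_or_lt with rfl | ht
  · rw [thenTravel_pos_of_le le_rfl, travel_self]
  · exact if_neg ht.not_ge

theorem Schedule.MovesFrom.thenTravel (h : s.MovesFrom x t₀) (ht₁ : t₀ ≤ t₁) (p : ℝ) :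
    (s.thenTravel t₁ p).MovesFrom x t₀ := by
  refine ⟨(thenTravel_pos_of_le ht₁).trans h.1, fun t t' ht ht' => ?_⟩
  wlog htt' : t ≤ t' generalizing t t'
  · simpa only [abs_sub_comm] using this t' t ht' ht (le_of_not_ge htt')
  have hlate (τ τ' : ℝ) (hτ : t₁ ≤ τ) (hτ' : t₁ ≤ τ') :
      |(s.thenTravel t₁ p).pos τ - (s.thenTravel t₁ p).pos τ'| ≤ |τ - τ'| := by
    simpa only [thenTravel_pos_of_ge hτ, thenTravel_pos_of_ge hτ'] using
      abs_travel_sub_travel_le _ _ _ _ _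
  rcases le_total t' t₁ with ht'₁ | ht'₁
  · simpa only [thenTravel_pos_of_le ht'₁, thenTravel_pos_of_le (htt'.trans ht'₁)] using
      h.2 t t' ht ht'
  rcases le_total t₁ t with htt₁ | htt₁
  · exact hlate t t' htt₁ ht'₁
  calc |(s.thenTravel t₁ p).pos t - (s.thenTravel t₁ p).pos t'|
      ≤ |(s.thenTravel t₁ p).pos t - (s.thenTravel t₁ p).pos t₁|
        + |(s.thenTravel t₁ p).pos t₁ - (s.thenTravel t₁ p).pos t'| := _root_.abs_sub_le _ _ _
    _ ≤ |t - t₁| + |t₁ - t'| := by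
        refine add_le_add ?_ (hlate t₁ t' le_rfl ht'₁)
        simpa only [thenTravel_pos_of_le htt₁, thenTravel_pos_of_le le_rfl] using h.2 t t₁ ht ht₁
    _ = |t - t'| := by
        rw [abs_of_nonpos (sub_nonpos.2 htt₁), abs_of_nonpos (sub_nonpos.2 ht'₁),
          abs_of_nonpos (sub_nonpos.2 htt')]
        ring

theorem Schedule.RespectsCapacity.mono (h : s.RespectsCapacity c R) (hR : R' ⊆ R) :
    s.RespectsCapacity c R' := by
  have hcard (p : Request → Prop) [DecidablePred p] :
      ((R'.filter p).card : ℕ∞) ≤ (R.filter p).card :=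
    mod_cast Finset.card_le_card (Finset.filter_subset_filter p hR)
  exact ⟨fun t => (hcard _).trans (h.1 t), fun r hr => (hcard _).trans_lt (h.2 r (hR hr))⟩

/-- A ride that begins when all others are over needs only one place. -/
theorem Schedule.RespectsCapacity.insert_last {s' : Schedule} (hc : 1 ≤ c)
    (h : s.RespectsCapacity c R) (hload : ∀ q ∈ R, q ≠ r → s'.load q = s.load q)
    (hunload : ∀ q ∈ R, q ≠ r → s'.unload q = s.unload q)
    (hle : ∀ q ∈ R, s.load q ≤ s.unload q) (hlast : ∀ q ∈ R, s.unload q ≤ s'.load r) :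
    s'.RespectsCapacity c (insert r R) := by
  have hcard {A B : Finset Request} (hAB : A ⊆ B) : (A.card : ℕ∞) ≤ B.card :=
    mod_cast Finset.card_le_card hAB
  have hold {q : Request} (hq : q ∈ insert r R) (hqr : q ≠ r) : q ∈ R ∧ s'.load q = s.load q ∧
      s'.unload q = s.unload q ∧ s.load q ≤ s.unload q ∧ s.unload q ≤ s'.load r := by
    have hqR := Finset.mem_of_mem_insert_of_ne hq hqr
    exact ⟨hqR, hload q hqR hqr, hunload q hqR hqr, hle q hqR, hlast q hqR⟩
  constructor
  · intro t
    rcases lt_or_ge t (s'.load r) with ht | ht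
    · refine (hcard fun q hq => ?_).trans (h.1 t)
      obtain ⟨hq, hqt⟩ := Finset.mem_filter.1 hq
      obtain ⟨hqR, hl, hu, -⟩ := hold hq (by rintro rfl; exact ht.not_ge hqt.1)
      exact Finset.mem_filter.2 ⟨hqR, hl ▸ hu ▸ hqt⟩
    · refine (hcard (B := {r}) fun q hq => Finset.mem_singleton.2 ?_).trans (by simpa using hc)
      obtain ⟨hq, -, hqt⟩ := Finset.mem_filter.1 hq
      by_contra hqr
      linarith [hold hq hqr]
  · intro q hq
    rcases eq_or_ne q r with rfl | hqr
    · rw [Finset.filter_eq_empty_iff.2 fun p hp hpq => ?_]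
      · simpa using zero_lt_one.trans_le hc
      linarith [hold hp (by rintro rfl; exact hpq.1.false)]
    · obtain ⟨hqR, hl, -, hlu, hur⟩ := hold hq hqr
      refine (hcard fun p hp => ?_).trans_lt (h.2 q hqR)
      obtain ⟨hp, hpq⟩ := Finset.mem_filter.1 hp
      obtain ⟨hpR, hl', hu', -⟩ := hold hp (by rintro rfl; linarith)
      exact Finset.mem_filter.2 ⟨hpR, hl ▸ hl' ▸ hu' ▸ hpq⟩

/-- Starting at time `t₀` in `x`, the server can have served the requests in `R` and be in `y` at
time `t`. -/
def CanServe (c : ℕ∞) (R : Finset Request) (x t₀ y t : ℝ) : Prop :=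
  ∃ s : Schedule, s.Serves c R x t₀ ∧ s.pos t = y ∧ s.finish = t

theorem canServe_empty (c : ℕ∞) (x t₀ : ℝ) : CanServe c ∅ x t₀ x t₀ :=
  ⟨⟨fun _ => x, 0, 0, t₀⟩, ⟨⟨rfl, by simp⟩, le_rfl, by simp, by simp, by simp⟩, rfl, rfl⟩

theorem CanServe.ride (hc : 1 ≤ c) (h : CanServe c R x t₀ y t₁) (hrel : r.release ≤ t₂)
    (hsrc : |r.src - y| ≤ t₂ - t₁) (hdst : |r.dst - r.src| ≤ t - t₂) :
    CanServe c (insert r R) x t₀ r.dst t := by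
  obtain ⟨s, ⟨hm, ht₁, hR, hcap⟩, rfl, rfl⟩ := h
  have ht₂ : s.finish ≤ t₂ := sub_nonneg.1 ((abs_nonneg _).trans hsrc)
  have ht : t₂ ≤ t := sub_nonneg.1 ((abs_nonneg _).trans hdst)
  let s₂ := (s.thenTravel s.finish r.src).thenTravel t₂ r.dst
  let s' : Schedule := ⟨s₂.pos, Function.update s.load r t₂, Function.update s.unload r t, t⟩
  have hearly {τ : ℝ} (hτ : τ ≤ s.finish) : s₂.pos τ = s.pos τ := by
    rw [Schedule.thenTravel_pos_of_le (hτ.trans ht₂), Schedule.thenTravel_pos_of_le hτ]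
  have hpos₁ : (s.thenTravel s.finish r.src).pos t₂ = r.src := by
    rw [Schedule.thenTravel_pos_of_ge ht₂, travel_of_abs_le hsrc]
  have hpos₂ : s₂.pos t₂ = r.src := (Schedule.thenTravel_pos_of_le le_rfl).trans hpos₁
  have hpos₃ : s₂.pos t = r.dst := by
    rw [Schedule.thenTravel_pos_of_ge ht, hpos₁, travel_of_abs_le hdst]
  refine ⟨s', ⟨(hm.thenTravel ht₁ _).thenTravel (ht₁.trans ht₂) _, by grind, fun q hq => ?_,
    hcap.insert_last hc (by grind) (by grind) (by grind) (by grind)⟩, hpos₃, rfl⟩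
  rcases eq_or_ne q r with rfl | hqr
  · simp only [s', Function.update_self]
    exact ⟨ht₁.trans ht₂, hrel, hpos₂, ht, hpos₃, le_rfl⟩
  · obtain ⟨h₁, h₂, h₃, h₄, h₅, h₆⟩ := hR q (Finset.mem_of_mem_insert_of_ne hq hqr)
    simp only [s', Function.update_of_ne hqr, hearly h₆, hearly (h₄.trans h₆)]
    exact ⟨h₁, h₂, h₃, h₄, h₅, h₆.trans (ht₂.trans ht)⟩

theorem CanServe.visit {p τ : ℝ} (hc : 1 ≤ c) (h : CanServe c R x t₀ y t₁) (hrel : τ ≤ t)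
    (hp : |p - y| ≤ t - t₁) : CanServe c (insert ⟨p, p, τ⟩ R) x t₀ p t :=
  h.ride (r := ⟨p, p, τ⟩) hc hrel hp (by simp)

theorem exists_canServe (hc : 1 ≤ c) (R : Finset Request) (x t₀ : ℝ) :
    ∃ y t, CanServe c R x t₀ y t := by
  induction R using Finset.induction with
  | empty => exact ⟨x, t₀, canServe_empty c x t₀⟩
  | insert r R _ ih =>
    obtain ⟨y, t, h⟩ := ih
    exact ⟨r.dst, _, h.ride hc (le_max_right (t + |r.src - y|) r.release)
      (by linarith [le_max_left (t + |r.src - y|) r.release]) (add_sub_cancel_left _ _).ge⟩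

theorem Schedule.Serves.mono (h : s.Serves c R x t₀) (hR : R' ⊆ R) : s.Serves c R' x t₀ :=
  ⟨h.1, h.2.1, fun r hr => h.2.2.1 r (hR hr), h.2.2.2.mono hR⟩

theorem Schedule.Serves.add_abs_le_load (hs : s.Serves c R x t₀) (hr : r ∈ R) :
    t₀ + |r.src - x| ≤ s.load r := by
  obtain ⟨hload, -, hsrc, -⟩ := hs.2.2.1 r hr
  linarith [hsrc ▸ hs.1.abs_sub_le hload]

theorem Schedule.Serves.add_abs_le_unload (hs : s.Serves c R x t₀) (hr : r ∈ R) :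
    t₀ + |r.dst - x| ≤ s.unload r := by
  obtain ⟨hload, -, -, hle, hdst, -⟩ := hs.2.2.1 r hr
  linarith [hdst ▸ hs.1.abs_sub_le (hload.trans hle)]

theorem Schedule.Serves.load_add_abs_le_unload (hs : s.Serves c R x t₀) (hr : r ∈ R)
    (hr' : r' ∈ R) (h : s.load r ≤ s.unload r') : s.load r + |r'.dst - r.src| ≤ s.unload r' := by
  obtain ⟨hload, -, hsrc, -⟩ := hs.2.2.1 r hr
  obtain ⟨-, -, -, -, hdst, -⟩ := hs.2.2.1 r' hr'
  linarith [hdst ▸ hsrc ▸ hs.1.abs_pos_sub_pos_le hload h]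

theorem Schedule.Serves.unload_add_abs_le_unload (hs : s.Serves c R x t₀) (hr : r ∈ R)
    (hr' : r' ∈ R) (h : s.unload r ≤ s.unload r') :
    s.unload r + |r'.dst - r.dst| ≤ s.unload r' := by
  obtain ⟨hload, -, -, hle, hdst, -⟩ := hs.2.2.1 r hr
  obtain ⟨-, -, -, -, hdst', -⟩ := hs.2.2.1 r' hr'
  linarith [hdst' ▸ hdst ▸ hs.1.abs_pos_sub_pos_le (hload.trans hle) h]

theorem Schedule.Serves.load_le_unload (hs : s.Serves c R x t₀) (hr : r ∈ R) :
    s.load r ≤ s.unload r :=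
  (hs.2.2.1 r hr).2.2.2.1

theorem Schedule.Serves.unload_le_finish (hs : s.Serves c R x t₀) (hr : r ∈ R) :
    s.unload r ≤ s.finish :=
  (hs.2.2.1 r hr).2.2.2.2.2

theorem Schedule.Serves.add_abs_le_finish (hs : s.Serves c R x t₀) (hr : r ∈ R) :
    t₀ + |r.dst - x| ≤ s.finish :=
  (hs.add_abs_le_unload hr).trans (hs.unload_le_finish hr)

theorem Schedule.Serves.pos_finish_eq_dst (hs : s.Serves c R x t₀) (hr : r ∈ R)
    (h : s.finish ≤ s.unload r) : s.pos s.finish = r.dst := by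
  rw [← (hs.unload_le_finish hr).antisymm h]
  exact (hs.2.2.1 r hr).2.2.2.2.1

theorem TieBreaking.follow_serves_of_canServe (tb : TieBreaking c) (h : List Request)
    (hserve : CanServe c R x t₀ y t) (hmin : ∀ s : Schedule, s.Serves c R x t₀ → t ≤ s.finish) :
    (tb.follow h R x t₀).Serves c R x t₀ ∧ (tb.follow h R x t₀).finish = t := by
  obtain ⟨s, hs, -, rfl⟩ := hserve
  obtain ⟨hserves, hle⟩ := tb.follow_spec h R x t₀ ⟨s, hs, hmin⟩
  exact ⟨hserves, (hle s hs).antisymm (hmin _ hserves)⟩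

theorem CanServe.opt_le (h : CanServe c R 0 0 y t) : opt c R ≤ t := by
  obtain ⟨s, hs, -, rfl⟩ := h
  exact csInf_le ⟨0, by rintro _ ⟨s', hs', rfl⟩; exact hs'.2.1⟩ ⟨s, hs, rfl⟩

theorem le_opt (hc : 1 ≤ c) (h : ∀ s : Schedule, s.Serves c R 0 0 → T ≤ s.finish) :
    T ≤ opt c R := by
  obtain ⟨-, t, s, hs, -, -⟩ := exists_canServe hc R 0 0
  exact le_csInf ⟨_, s, hs, rfl⟩ (by rintro _ ⟨s', hs', rfl⟩; exact h s' hs')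

theorem abs_dst_le_opt (hc : 1 ≤ c) (hr : r ∈ R) : |r.dst| ≤ opt c R :=
  le_opt hc fun s hs => by simpa using hs.add_abs_le_finish hr

theorem opt_mono (hc : 1 ≤ c) (hR : R' ⊆ R) : opt c R' ≤ opt c R :=
  le_opt hc fun s hs => CanServe.opt_le ⟨s, hs.mono hR, rfl, rfl⟩

/-- The requests from `R` that are on board at time `t` when `s` is carried out. -/
noncomputable def Schedule.onBoard (s : Schedule) (R : Finset Request) (t : ℝ) : Finset Request :=
  R.filter (fun r => s.load r ≤ t ∧ t < s.unload r)

theorem Schedule.mem_onBoard :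
    r ∈ s.onBoard R t ↔ r ∈ R ∧ s.load r ≤ t ∧ t < s.unload r :=
  Finset.mem_filter

/-- Starting at time `t₀` in `x` with the requests in `L` on board, the server can deliver them and
be back in the origin by time `t`: the condition that makes `Lazy(α)` abort its command. -/
def CanReturn (L : Finset Request) (x t₀ t : ℝ) : Prop :=
  ∃ s : Schedule, s.Returns L x t₀ ∧ s.finish ≤ t

theorem CanReturn.add_abs_le (h : CanReturn L x t₀ t) : t₀ + |x| ≤ t := by
  obtain ⟨s, ⟨hm, hle, -, hzero⟩, hfin⟩ := h
  have hback := hm.abs_sub_le hle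
  rw [hzero, zero_sub, abs_neg] at hback
  linarith

theorem CanReturn.add_abs_add_abs_le (h : CanReturn L x t₀ t) (hr : r ∈ L) :
    t₀ + |r.dst - x| + |r.dst| ≤ t := by
  obtain ⟨s, ⟨hm, -, hL, hzero⟩, hfin⟩ := h
  obtain ⟨hunload, hdst, hle⟩ := hL r hr
  have hdeliver := hm.abs_sub_le hunload
  have hback := hm.abs_pos_sub_pos_le hunload hle
  rw [hdst] at hdeliver
  rw [hzero, hdst, zero_sub, abs_neg] at hback
  linarith

theorem isShortestReturn_empty (t₀ : ℝ) :
    Schedule.IsShortestReturn ⟨0, 0, 0, t₀⟩ ∅ 0 t₀ :=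
  ⟨⟨⟨rfl, by simp⟩, le_rfl, by simp, rfl⟩, fun _ hs => hs.2.1⟩

end Schedules

section Executions

variable {C : Config} {R N : Finset Request} {s : Schedule} {r : Request}
  {h new early future : List Request} {cmd : Command} {x t D : ℝ}

/-- From the configuration `C` on, the algorithm does not complete before time `T`. -/
def Late (tb : TieBreaking c) (α T : ℝ) (C : Config) : Prop :=
  ∀ k : ℕ, ((Config.step tb α)^[k] C).Done → T ≤ ((Config.step tb α)^[k] C).time

theorem Late.of_step (hC : ¬C.Done) (hL : Late tb α T (C.step tb α)) : Late tb α T C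
  | 0, hk => absurd hk hC
  | k + 1, hk => hL k hk

theorem ofReal_div_le_lazyCompetitiveRatio {σ : List Request} (hσ : IsRequestSequence σ)
    (hT : Late tb α T (Config.init σ)) {O : ℝ} (hO : 0 < O) (hopt : opt c σ.toFinset ≤ O) :
    ENNReal.ofReal (T / O) ≤ lazyCompetitiveRatio tb α :=
  calc ENNReal.ofReal (T / O) = ENNReal.ofReal T / ENNReal.ofReal O :=
        ENNReal.ofReal_div_of_pos hO
    _ ≤ lazyTime tb α σ / ENNReal.ofReal (opt c σ.toFinset) :=
        ENNReal.div_le_div (le_iInf₂ fun k hk => ENNReal.ofReal_le_ofReal (hT k hk))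
          (ENNReal.ofReal_le_ofReal hopt)
    _ ≤ lazyCompetitiveRatio tb α :=
        le_iSup₂ (f := fun (σ : List Request) (_ : IsRequestSequence σ) =>
          lazyTime tb α σ / ENNReal.ofReal (opt c σ.toFinset)) σ hσ

theorem Config.step_eq_complete {e : ℝ} (he : C.cmd.finish? = some e)
    (hfut : ∀ r ∈ C.future, e < r.release) : C.step tb α = C.complete tb α e := by
  unfold Config.step
  rw [he]
  generalize hf : C.future = f at hfut
  cases f with
  | nil => rfl
  | cons r rest => exact if_neg (hfut r List.mem_cons_self).not_ge

theorem Config.step_eq_uponRequest (hf : C.future = r :: future)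
    (he : ∀ e, C.cmd.finish? = some e → r.release ≤ e) :
    C.step tb α = (C.register r future).uponRequest tb α := by
  unfold Config.step
  rw [hf]
  generalize C.cmd.finish? = o at he
  cases o with
  | none => rfl
  | some e => exact if_pos (he e rfl)

theorem Config.whenIdle_of_lt (hlt : C.time < α * C.opt c) :
    C.whenIdle tb α = { C with cmd := .wait (α * C.opt c) } :=
  if_pos hlt

theorem Config.whenIdle_of_le (hle : α * C.opt c ≤ C.time) (hp : C.pending.Nonempty) :
    C.whenIdle tb α =
      { C with cmd := .follow C.pending (tb.follow C.released C.pending C.pos C.time) } :=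
  (if_neg hle.not_gt).trans (if_pos hp.ne_empty)

theorem Config.whenIdle_of_pending_eq_empty (hle : α * C.opt c ≤ C.time) (hp : C.pending = ∅) :
    C.whenIdle tb α = { C with cmd := .idle } :=
  (if_neg hle.not_gt).trans (if_neg (not_not.2 hp))

theorem Config.uponRequest_of_canReturn
    (hret : CanReturn C.loaded C.pos C.time (α * C.opt c)) :
    C.uponRequest tb α = { C with cmd := .ret (tb.ret C.released C.loaded C.pos C.time) } :=
  if_pos hret

theorem Config.uponRequest_of_idle (hcmd : C.cmd = .idle)
    (hret : ¬CanReturn C.loaded C.pos C.time (α * C.opt c)) :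
    C.uponRequest tb α = C.whenIdle tb α := by
  refine (if_neg hret).trans ?_
  rw [hcmd]

theorem Config.uponRequest_of_follow (hcmd : C.cmd = .follow R s)
    (hret : ¬CanReturn C.loaded C.pos C.time (α * C.opt c)) : C.uponRequest tb α = C := by
  refine (if_neg hret).trans ?_
  rw [hcmd]

/-- All requests have been served, at time `T` or later, and the server does not move any more. -/
def Config.Served (T : ℝ) (C : Config) : Prop :=
  T ≤ C.time ∧ C.future = [] ∧ C.pending = ∅ ∧ (C.cmd = .idle ∨ ∃ T', T ≤ T' ∧ C.cmd = .wait T')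

theorem Config.Served.whenIdle (hC : C.Served T) : (C.whenIdle tb α).Served T := by
  obtain ⟨hT, hfut, hpending, -⟩ := hC
  rcases lt_or_ge C.time (α * C.opt c) with hlt | hle
  · rw [whenIdle_of_lt hlt]
    exact ⟨hT, hfut, hpending, .inr ⟨_, hT.trans hlt.le, rfl⟩⟩
  · rw [whenIdle_of_pending_eq_empty hle hpending]
    exact ⟨hT, hfut, hpending, .inl rfl⟩

theorem Config.Served.step (hC : C.Served T) : (C.step tb α).Served T := by
  obtain ⟨time, pos, loaded, pending, cmd, released, future⟩ := C
  obtain ⟨hT, rfl, rfl, rfl | ⟨T', hT', rfl⟩⟩ := hC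
  · exact ⟨hT, rfl, rfl, .inl rfl⟩
  · rw [step_eq_complete (e := T') rfl (by simp)]
    exact whenIdle ⟨hT', rfl, rfl, .inl rfl⟩

theorem Config.Served.late (hC : C.Served T) : Late tb α T C := by
  have hserved (k : ℕ) : ((Config.step tb α)^[k] C).Served T := by
    induction k with
    | zero => exact hC
    | succ k ih =>
      rw [Function.iterate_succ_apply']
      exact ih.step
  exact fun k _ => (hserved k).1

/-- At time `t`, when `h` has been released, the empty server starts in `x` to follow a shortest
schedule for the requests in `R`. -/
def Config.starting (tb : TieBreaking c) (h : List Request) (R : Finset Request) (x t : ℝ)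
    (future : List Request) : Config :=
  ⟨t, x, ∅, R, .follow R (tb.follow h R x t), h, future⟩

/-- The server follows the schedule `s` for the requests in `R`. Besides these, the requests in `N`
wait to be served. -/
structure Config.IsFollowing (C : Config) (R N : Finset Request) (s : Schedule)
    (h future : List Request) : Prop where
  cmd : C.cmd = .follow R s
  pending : C.pending \ R = N
  released : C.released = h
  future : C.future = future

theorem Config.starting_isFollowing :
    (starting tb h R x t future).IsFollowing R ∅ (tb.follow h R x t) h future :=
  ⟨rfl, Finset.sdiff_self R, rfl, rfl⟩

theorem Config.IsFollowing.step_of_release (hC : C.IsFollowing R N s h (r :: future))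
    (hrR : r ∉ R) (hr : r.release ≤ s.finish)
    (hret : ¬CanReturn (s.onBoard R r.release) (s.pos r.release) r.release
      (α * DialARide.opt c (r :: h).toFinset)) :
    (C.step tb α).IsFollowing R (insert r N) s (r :: h) future := by
  obtain ⟨time, pos, loaded, pending, cmd, released, future'⟩ := C
  obtain ⟨rfl, rfl, rfl, rfl⟩ := hC
  rw [step_eq_uponRequest (r := r) (future := future) rfl (by simpa [Command.finish?] using hr),
    uponRequest_of_follow (R := R) (s := s) rfl hret]
  refine ⟨rfl, ?_, rfl, rfl⟩
  ext q
  simp only [register, advance, Finset.mem_sdiff, Finset.mem_insert, Finset.mem_filter]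
  grind

theorem Config.IsFollowing.step_of_finish (hC : C.IsFollowing R N s h future)
    (hs : s.Serves c R x t) (hN : N.Nonempty) (hfut : ∀ r ∈ future, s.finish < r.release)
    (hopt : α * DialARide.opt c h.toFinset ≤ s.finish) :
    C.step tb α = starting tb h N (s.pos s.finish) s.finish future := by
  obtain ⟨time, pos, loaded, pending, cmd, released, future'⟩ := C
  obtain ⟨rfl, rfl, rfl, rfl⟩ := hC
  have hadv : advance ⟨time, pos, loaded, pending, .follow R s, released, future'⟩ s.finish =
      ⟨s.finish, s.pos s.finish, ∅, pending \ R, .follow R s, released, future'⟩ := by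
    have hdelivered : R.filter (fun q => s.load q ≤ s.finish ∧ s.finish < s.unload q) = ∅ :=
      Finset.filter_eq_empty_iff.2 fun q hq hfin => (hs.unload_le_finish hq).not_gt hfin.2
    have hleft : pending.filter (fun q => ¬(q ∈ R ∧ s.load q ≤ s.finish)) = pending \ R := by
      ext q
      have hload : q ∈ R → s.load q ≤ s.finish := fun hq =>
        (hs.load_le_unload hq).trans (hs.unload_le_finish hq)
      simp only [Finset.mem_filter, Finset.mem_sdiff]
      tauto
    simp only [advance, hdelivered, hleft]
  rw [step_eq_complete (e := s.finish) rfl hfut, complete, hadv]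
  exact whenIdle_of_le (C := ⟨_, _, ∅, _, .idle, released, future'⟩) hopt hN

theorem Config.IsFollowing.late (hc : 1 ≤ c) (hα : 0 ≤ α)
    (hC : C.IsFollowing R N s h (new ++ future)) (hs : s.Serves c R x t)
    (hN : (new.toFinset ∪ N).Nonempty) (hnew : ∀ r ∈ new, r ∉ R ∧ r.release ≤ s.finish)
    (hfut : ∀ r ∈ future, s.finish < r.release)
    (hopt : α * DialARide.opt c (new.reverse ++ h).toFinset ≤ D) (hD : D ≤ s.finish)
    (hret : ∀ r ∈ new, ¬CanReturn (s.onBoard R r.release) (s.pos r.release) r.release D)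
    (hL : Late tb α T (starting tb (new.reverse ++ h) (new.toFinset ∪ N) (s.pos s.finish) s.finish
      future)) :
    Late tb α T C := by
  induction new generalizing C N h with
  | nil =>
    simp only [List.toFinset_nil, Finset.empty_union] at hN hL
    refine Late.of_step (fun hdone => ?_) ?_
    · obtain ⟨q, hq⟩ := hN
      simp [← hC.pending, hdone.2.1] at hq
    · rwa [hC.step_of_finish hs hN hfut (hopt.trans hD)]
  | cons r new ih =>
    simp only [List.forall_mem_cons] at hnew hret
    simp only [List.reverse_cons, List.append_assoc, List.singleton_append, List.toFinset_cons,
      Finset.insert_union, ← Finset.union_insert] at hN hopt hL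
    refine Late.of_step (fun hdone => by simpa [hC.future] using hdone.1)
      (ih (hC.step_of_release hnew.1.1 hnew.1.2 ?_) hN hnew.2 hopt hret.2 hL)
    rintro ⟨s', hs', hle⟩
    have hmono : DialARide.opt c (r :: h).toFinset ≤
        DialARide.opt c (new.reverse ++ r :: h).toFinset :=
      opt_mono hc (by simp)
    exact hret.1 ⟨s', hs', hle.trans ((mul_le_mul_of_nonneg_left hmono hα).trans hopt)⟩

theorem Late.starting_append (hc : 1 ≤ c) (hα : 0 ≤ α)
    (hs : (tb.follow h R x t).Serves c R x t) (hne : new ≠ [])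
    (hnew : ∀ r ∈ new, r ∉ R ∧ r.release ≤ (tb.follow h R x t).finish)
    (hfut : ∀ r ∈ future, (tb.follow h R x t).finish < r.release)
    (hopt : α * opt c (new.reverse ++ h).toFinset ≤ D) (hD : D ≤ (tb.follow h R x t).finish)
    (hret : ∀ r ∈ new, ¬CanReturn ((tb.follow h R x t).onBoard R r.release)
      ((tb.follow h R x t).pos r.release) r.release D)
    (hL : Late tb α T (.starting tb (new.reverse ++ h) new.toFinset
      ((tb.follow h R x t).pos (tb.follow h R x t).finish) (tb.follow h R x t).finish future)) :
    Late tb α T (.starting tb h R x t (new ++ future)) :=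
  Config.starting_isFollowing.late hc hα hs (by simpa using hne) hnew hfut hopt hD hret
    (by rwa [Finset.union_empty])

theorem Late.starting_nil (hR : R.Nonempty) (hs : (tb.follow h R x t).Serves c R x t)
    (hT : T ≤ (tb.follow h R x t).finish) : Late tb α T (.starting tb h R x t []) := by
  refine Late.of_step (fun hdone => hR.ne_empty hdone.2.1) ?_
  rw [Config.step_eq_complete (e := (tb.follow h R x t).finish) rfl (by simp [Config.starting])]
  refine (Config.Served.whenIdle ⟨hT, rfl, Finset.filter_eq_empty_iff.2 fun q hq => ?_,
    .inl rfl⟩).late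
  exact not_not.2 ⟨hq, (hs.load_le_unload hq).trans (hs.unload_le_finish hq)⟩

theorem Late.starting_visit {p τ : ℝ} (hc : 1 ≤ c) (hτ : τ ≤ t) (hT : T ≤ t + |p - x|) :
    Late tb α T (.starting tb h {⟨p, p, τ⟩} x t []) := by
  have hvisit : CanServe c {⟨p, p, τ⟩} x t p (t + |p - x|) :=
    (canServe_empty c x t).visit hc (hτ.trans (le_add_of_nonneg_right (abs_nonneg _)))
      (add_sub_cancel_left _ _).ge
  obtain ⟨hs, hfin⟩ := tb.follow_serves_of_canServe h hvisit fun s hs =>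
    hs.add_abs_le_finish (Finset.mem_singleton_self _)
  exact Late.starting_nil (Finset.singleton_nonempty _) hs (hT.trans hfin.ge)

/-- The empty server rests in the origin and has not served any of the requests in `h`, which have
been released. -/
noncomputable def Config.resting (t : ℝ) (cmd : Command) (h future : List Request) : Config :=
  ⟨t, 0, ∅, h.toFinset, cmd, h, future⟩

theorem Late.resting_release (hcmd : cmd = .idle ∨ ∃ T', cmd = .wait T' ∧ r.release ≤ T')
    (hfut : ∀ r' ∈ future, r.release < r'.release)
    (hopt : r.release < α * opt c (r :: h).toFinset)
    (hL : Late tb α T (.resting r.release (.wait (α * opt c (r :: h).toFinset)) (r :: h) future)) :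
    Late tb α T (.resting t cmd h (r :: future)) := by
  let C := Config.resting r.release cmd (r :: h) future
  let s := tb.ret (r :: h) ∅ 0 r.release
  have hstay := isShortestReturn_empty r.release
  obtain ⟨⟨⟨hpos, -⟩, hle, -⟩, hmin⟩ : s.IsShortestReturn ∅ 0 r.release :=
    tb.ret_spec _ _ _ _ ⟨_, hstay⟩
  have hfin : s.finish = r.release := (hmin _ hstay.1).antisymm hle
  have hrequest : (Config.resting t cmd h (r :: future)).step tb α = { C with cmd := .ret s } := by
    have hwait (e : ℝ) (he : cmd.finish? = some e) : r.release ≤ e := by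
      rcases hcmd with rfl | ⟨T', rfl, hT'⟩ <;> cases he
      exact hT'
    rw [Config.step_eq_uponRequest (r := r) (future := future) rfl hwait]
    have hreg : (Config.resting t cmd h (r :: future)).register r future = C := by
      simp only [C, Config.resting, List.toFinset_cons]
      rcases hcmd with rfl | ⟨_, rfl, -⟩ <;> rfl
    rw [hreg]
    exact Config.uponRequest_of_canReturn ⟨_, hstay.1, hopt.le⟩
  have hreturned : Config.step tb α { C with cmd := .ret s } =
      .resting r.release (.wait (α * opt c (r :: h).toFinset)) (r :: h) future := by
    rw [Config.step_eq_complete (C := { C with cmd := .ret s }) (congrArg some hfin) hfut,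
      Config.complete]
    have hadv : Config.advance { C with cmd := .ret s } r.release = { C with cmd := .ret s } := by
      simp only [Config.advance, hpos, C, Config.resting, Finset.filter_empty]
    rw [hadv]
    exact Config.whenIdle_of_lt hopt
  have hpending : (r :: h).toFinset ≠ ∅ := by simp
  refine Late.of_step (fun hdone => List.cons_ne_nil _ _ hdone.1) ?_
  rw [hrequest]
  refine Late.of_step (fun hdone => hpending hdone.2.1) ?_
  rwa [hreturned]

theorem Late.resting_wait (hc : 1 ≤ c) (hα : 0 ≤ α) (hne : h ≠ [])
    (hsorted : (early ++ future).Pairwise fun r r' => r.release < r'.release)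
    (hearly : ∀ r ∈ early, r.release < α * opt c h.toFinset)
    (hfut : ∀ r ∈ future, α * opt c (early.reverse ++ h).toFinset < r.release)
    (hL : Late tb α T (.starting tb (early.reverse ++ h) (early.reverse ++ h).toFinset 0
      (α * opt c (early.reverse ++ h).toFinset) future)) :
    Late tb α T (.resting t (.wait (α * opt c h.toFinset)) h (early ++ future)) := by
  induction early generalizing h t with
  | nil =>
    have hpending : h.toFinset.Nonempty := List.toFinset_nonempty_iff h |>.2 hne
    refine Late.of_step (fun hdone => hpending.ne_empty hdone.2.1) ?_
    rw [Config.step_eq_complete (e := α * opt c h.toFinset) rfl hfut, Config.complete,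
      Config.whenIdle_of_le le_rfl hpending]
    exact hL
  | cons r early ih =>
    simp only [List.forall_mem_cons, List.cons_append, List.pairwise_cons] at hearly hsorted
    have hmono : α * opt c h.toFinset ≤ α * opt c (r :: h).toFinset :=
      mul_le_mul_of_nonneg_left (opt_mono hc (by simp)) hα
    simp only [List.reverse_cons, List.append_assoc, List.singleton_append] at hfut hL
    exact Late.resting_release (.inr ⟨_, rfl, hearly.1.le⟩) hsorted.1 (hearly.1.trans_le hmono)
      (ih (List.cons_ne_nil _ _) hsorted.2 (fun q hq => (hearly.2 q hq).trans_le hmono) hfut hL)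

theorem Late.init_wait (hc : 1 ≤ c) (hα : 0 ≤ α)
    (hsorted : (r :: early ++ future).Pairwise fun r r' => r.release < r'.release)
    (hearly : ∀ q ∈ r :: early, q.release < α * opt c {r})
    (hfut : ∀ q ∈ future, α * opt c (r :: early).toFinset < q.release)
    (hL : Late tb α T (.starting tb (r :: early).reverse (r :: early).toFinset 0
      (α * opt c (r :: early).toFinset) future)) :
    Late tb α T (.init (r :: early ++ future)) := by
  rw [← List.toFinset_reverse, List.reverse_cons] at hfut hL
  rw [List.cons_append, List.pairwise_cons] at hsorted
  rw [List.forall_mem_cons] at hearly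
  exact Late.resting_release (h := []) (.inl rfl) hsorted.1 hearly.1
    (Late.resting_wait hc hα (List.cons_ne_nil _ _) hsorted.2 hearly.2 hfut hL)

theorem Late.init_start (hopt : α * opt c {r} < r.release)
    (hL : Late tb α T (.starting tb [r] {r} 0 r.release future)) :
    Late tb α T (.init (r :: future)) := by
  have hret : ¬CanReturn ∅ 0 r.release (α * opt c {r}) := fun hret =>
    hopt.not_ge (by simpa using hret.add_abs_le)
  refine Late.of_step (fun hdone => List.cons_ne_nil _ _ hdone.1) ?_
  have hreg : (Config.init (r :: future)).register r future =
      ⟨r.release, 0, ∅, {r}, .idle, [r], future⟩ := rfl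
  rw [Config.step_eq_uponRequest (r := r) (future := future) rfl
      (by simp [Config.init, Command.finish?]), hreg, Config.uponRequest_of_idle rfl hret,
    Config.whenIdle_of_le (C := ⟨r.release, 0, ∅, {r}, .idle, [r], future⟩) hopt.le
      (Finset.singleton_nonempty r)]
  exact hL

end Executions

section OneAddAlpha

theorem ofReal_one_add_le_lazyCompetitiveRatio (hc : 1 ≤ c) (hα : 0 < α) :
    ENNReal.ofReal (1 + α) ≤ lazyCompetitiveRatio tb α := by
  obtain ⟨τ, hτ, hτα⟩ := exists_between (lt_min hα one_pos)
  obtain ⟨hτα, hτ1⟩ := lt_min_iff.1 hτα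
  have hserve : CanServe c {⟨1, 1, τ⟩} 0 0 1 1 :=
    (canServe_empty c 0 0).visit hc hτ1.le (by norm_num)
  have hopt : opt c {⟨1, 1, τ⟩} = 1 := by
    refine hserve.opt_le.antisymm ?_
    simpa using abs_dst_le_opt hc (Finset.mem_singleton_self (⟨1, 1, τ⟩ : Request))
  have hL : Late tb α (1 + α) (.init [⟨1, 1, τ⟩]) := by
    refine Late.init_wait (early := []) (future := []) hc hα.le (List.pairwise_singleton _ _)
      (by simpa [hopt]) (by simp) ?_
    simp only [List.toFinset_cons, List.toFinset_nil, insert_empty_eq, hopt, mul_one]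
    exact Late.starting_visit hc hτα.le (by simp [add_comm])
  simpa using ofReal_div_le_lazyCompetitiveRatio
    ⟨List.cons_ne_nil _ _, by simpa, List.pairwise_singleton _ _⟩ hL one_pos hopt.le

end OneAddAlpha

section SmallAlpha

variable {s : Schedule} {R : Finset Request} {h : List Request} {δ t t' t₀ : ℝ}

theorem Schedule.Serves.origin_ride_le_finish (hδ : 0 < δ)
    (hs : s.Serves c {⟨0, 0, t⟩, ⟨1 / 2 + δ, 1, t'⟩} 1 t₀) :
    t₀ + 2 - 2 * δ ≤ s.finish ∧ (s.finish ≤ t₀ + 2 - 2 * δ → s.pos s.finish = 0) := by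
  set visit : Request := ⟨0, 0, t⟩ with hvisit
  set ride : Request := ⟨1 / 2 + δ, 1, t'⟩ with hride
  have hvisit_mem : visit ∈ ({visit, ride} : Finset Request) := by simp
  have hride_mem : ride ∈ ({visit, ride} : Finset Request) := by simp
  have hvisit_le := hs.unload_le_finish hvisit_mem
  have hride_le := hs.unload_le_finish hride_mem
  rcases le_total (s.unload ride) (s.unload visit) with hle | hle
  · have hload := hs.add_abs_le_load hride_mem
    have hunload := hs.load_add_abs_le_unload hride_mem hride_mem (hs.load_le_unload hride_mem)
    have hback := hs.unload_add_abs_le_unload hride_mem hvisit_mem hle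
    have h₁ := neg_le_abs (ride.src - 1)
    have h₂ := le_abs_self (ride.dst - ride.src)
    have h₃ := neg_le_abs (visit.dst - ride.dst)
    simp only [hvisit, hride] at h₁ h₂ h₃ hload hunload hback
    exact ⟨by linarith, fun hfin => hs.pos_finish_eq_dst hvisit_mem (by linarith)⟩
  · have hunload := hs.add_abs_le_unload hvisit_mem
    have hback := hs.unload_add_abs_le_unload hvisit_mem hride_mem hle
    norm_num [hvisit, hride] at hunload hback
    constructor
    · linarith
    · intro hfin
      linarith

theorem TieBreaking.follow_origin_ride (hc : 1 ≤ c) (tb : TieBreaking c) (h : List Request)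
    (hδ : 0 < δ) (hδ' : δ < 1 / 2) (ht : t ≤ t₀) (ht' : t' ≤ t₀) :
    (tb.follow h {⟨0, 0, t⟩, ⟨1 / 2 + δ, 1, t'⟩} 1 t₀).Serves c
        {⟨0, 0, t⟩, ⟨1 / 2 + δ, 1, t'⟩} 1 t₀ ∧
      (tb.follow h {⟨0, 0, t⟩, ⟨1 / 2 + δ, 1, t'⟩} 1 t₀).finish = t₀ + 2 - 2 * δ ∧
      (tb.follow h {⟨0, 0, t⟩, ⟨1 / 2 + δ, 1, t'⟩} 1 t₀).pos (t₀ + 2 - 2 * δ) = 0 := by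
  have hride : CanServe c {⟨1 / 2 + δ, 1, t'⟩} 1 t₀ 1 (t₀ + 1 - 2 * δ) :=
    (canServe_empty c 1 t₀).ride (r := ⟨1 / 2 + δ, 1, t'⟩) (t₂ := t₀ + 1 / 2 - δ) hc
      (by dsimp only; linarith) (by rw [abs_le]; constructor <;> linarith)
      (by rw [abs_le]; constructor <;> linarith)
  have hserve : CanServe c {⟨0, 0, t⟩, ⟨1 / 2 + δ, 1, t'⟩} 1 t₀ 0 (t₀ + 2 - 2 * δ) :=
    hride.visit hc (by linarith) (by rw [abs_le]; constructor <;> linarith)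
  obtain ⟨hs, hfin⟩ := tb.follow_serves_of_canServe h hserve fun s hs =>
    (hs.origin_ride_le_finish hδ).1
  exact ⟨hs, hfin, hfin ▸ (hs.origin_ride_le_finish hδ).2 hfin.le⟩

/-- The final requests of the lower bound for `α < 1`, against a server that leaves the origin at
time `s` for `1` and cannot return in time. -/
noncomputable def trap (s δ : ℝ) : List Request :=
  [⟨0, 0, s + δ⟩, ⟨1 / 2 + δ, 1, s + 2 * δ⟩, ⟨1, 1, s + 1 + δ⟩]

theorem Late.starting_trap {s D : ℝ} (hc : 1 ≤ c) (hα : 0 ≤ α) (hδ : 0 < δ) (hδ' : δ < 1 / 4)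
    (hs : (tb.follow h R 0 s).Serves c R 0 s) (hfin : (tb.follow h R 0 s).finish = s + 1)
    (hend : (tb.follow h R 0 s).pos (s + 1) = 1) (hrel : ∀ r ∈ R, r.release < s + δ)
    (hopt : α * opt c (h ++ trap s δ).toFinset ≤ D) (hD : D < s + 1)
    (hret : ∀ t, s + δ ≤ t → t ≤ s + 2 * δ →
      ¬CanReturn ((tb.follow h R 0 s).onBoard R t) ((tb.follow h R 0 s).pos t) t D) :
    Late tb α (s + 4 - 2 * δ) (.starting tb h R 0 s (trap s δ)) := by
  have hopt' {l : List Request} (hl : l ⊆ h ++ trap s δ) : α * opt c l.toFinset ≤ D :=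
    (mul_le_mul_of_nonneg_left (opt_mono hc (Multiset.toFinset_subset.2 hl)) hα).trans hopt
  refine Late.starting_append (new := [⟨0, 0, s + δ⟩, ⟨1 / 2 + δ, 1, s + 2 * δ⟩])
    (future := [⟨1, 1, s + 1 + δ⟩]) hc hα hs (List.cons_ne_nil _ _) ?_ ?_ (hopt' ?_)
    (hfin ▸ hD.le) ?_ ?_
  · simp only [List.forall_mem_cons, hfin]
    exact ⟨⟨fun hr => (hrel _ hr).false, by linarith⟩,
      ⟨fun hr => (hrel _ hr).not_ge (by dsimp only; linarith), by linarith⟩, by simp⟩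
  · simpa [hfin]
  · simp [trap]
  · simp only [List.forall_mem_cons]
    exact ⟨hret _ le_rfl (by linarith), hret _ (by linarith) le_rfl, by simp⟩
  rw [hfin, hend]
  simp only [List.toFinset_cons, List.toFinset_nil, insert_empty_eq]
  obtain ⟨hs₂, hfin₂, hend₂⟩ := tb.follow_origin_ride hc
    ([⟨0, 0, s + δ⟩, ⟨1 / 2 + δ, 1, s + 2 * δ⟩].reverse ++ h) (t := s + δ) (t' := s + 2 * δ)
    (t₀ := s + 1) hδ (by linarith) (by linarith) (by linarith)
  refine Late.starting_append (new := [⟨1, 1, s + 1 + δ⟩]) (future := []) hc hα hs₂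
    (List.cons_ne_nil _ _) ?_ (by simp) (hopt' ?_) (by linarith) ?_ ?_
  · simp only [List.forall_mem_singleton, hfin₂, Finset.mem_insert, Finset.mem_singleton,
      Request.mk.injEq, not_or]
    exact ⟨⟨by simp, fun hr => by linarith⟩, by linarith⟩
  · simp [trap]
  · simp only [List.forall_mem_singleton]
    intro hback
    have := hback.add_abs_le.trans' (le_add_of_nonneg_right (abs_nonneg _))
    linarith
  rw [hfin₂, hend₂]
  exact Late.starting_visit hc (by linarith) (by norm_num; linarith)

theorem canServe_ride_visit (hc : 1 ≤ c) (hδ : 0 ≤ δ) (hδ' : δ ≤ 1 / 2) (ht : t ≤ t₀ + δ)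
    (ht' : t' ≤ t₀ + 1) : CanServe c {⟨δ, 1 / 2, t⟩, ⟨1, 1, t'⟩} 0 t₀ 1 (t₀ + 1) := by
  have h := ((canServe_empty c 0 t₀).ride (r := ⟨δ, 1 / 2, t⟩) (t₂ := t₀ + δ) (t := t₀ + 1 / 2) hc
    ht (by rw [abs_le]; constructor <;> linarith)
    (by rw [abs_le]; constructor <;> linarith)).visit hc (p := 1) ht'
    (by rw [abs_le]; constructor <;> linarith)
  rwa [insert_empty_eq, Finset.pair_comm] at h

theorem Schedule.Serves.ride_to_one (hδ : δ < 1)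
    (hs : s.Serves c {⟨δ, 1 / 2, t⟩, ⟨1, 1, t'⟩} 0 t₀) (hfin : s.finish = t₀ + 1) :
    s.pos (t₀ + 1) = 1 ∧ ∀ τ, t₀ + δ ≤ τ → τ < t₀ + 1 / 2 →
      ⟨δ, 1 / 2, t⟩ ∈ s.onBoard {⟨δ, 1 / 2, t⟩, ⟨1, 1, t'⟩} τ := by
  set ride : Request := ⟨δ, 1 / 2, t⟩
  set visit : Request := ⟨1, 1, t'⟩
  have hride : ride ∈ ({ride, visit} : Finset Request) := by simp
  have hvisit : visit ∈ ({ride, visit} : Finset Request) := by simp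
  have hunload : s.finish ≤ s.unload visit := by
    simpa [visit, hfin] using hs.add_abs_le_unload hvisit
  refine ⟨hfin ▸ hs.pos_finish_eq_dst hvisit hunload, fun τ hτ hτ' => ?_⟩
  have hload := hs.load_add_abs_le_unload hride hvisit
    ((hs.load_le_unload hride).trans ((hs.unload_le_finish hride).trans hunload))
  have hdist : |visit.dst - ride.src| = 1 - δ := abs_of_pos (sub_pos.2 hδ)
  have hride_unload : t₀ + 1 / 2 ≤ s.unload ride := by
    simpa [ride, abs_of_pos] using hs.add_abs_le_unload hride
  exact mem_onBoard.2 ⟨hride, by linarith [hs.unload_le_finish hvisit], by linarith⟩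

theorem opt_ride_append_trap_le (hc : 1 ≤ c) (hα : 0 ≤ α) (hδ : 0 < δ) (hδ' : δ < 1 / 4) :
    opt c (⟨δ, 1 / 2, δ⟩ :: ⟨1, 1, 2 * δ⟩ :: trap α δ).toFinset ≤ α + 1 + δ := by
  have h₁ := (canServe_empty c 0 0).visit (p := 0) (τ := α + δ) (t := α + δ) hc le_rfl
    (by norm_num; linarith)
  have h₂ := h₁.ride (r := ⟨δ, 1 / 2, δ⟩) (t₂ := α + 2 * δ) (t := α + 1 / 2 + δ) hc
    (by dsimp only; linarith) (by rw [abs_le]; constructor <;> linarith)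
    (by rw [abs_le]; constructor <;> linarith)
  have h₃ := h₂.ride (r := ⟨1 / 2 + δ, 1, α + 2 * δ⟩) (t₂ := α + 1 / 2 + 2 * δ) (t := α + 1 + δ) hc
    (by dsimp only; linarith) (by rw [abs_le]; constructor <;> linarith)
    (by rw [abs_le]; constructor <;> linarith)
  have h₄ := h₃.visit (p := 1) (τ := 2 * δ) (t := α + 1 + δ) hc (by linarith) (by simp)
  have h₅ := h₄.visit (p := 1) (τ := α + 1 + δ) (t := α + 1 + δ) hc le_rfl (by simp)
  refine (opt_mono hc fun r hr => ?_).trans h₅.opt_le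
  simp only [trap, List.mem_toFinset, List.mem_cons,
    List.not_mem_nil, Finset.mem_insert, Finset.notMem_empty, or_false] at hr ⊢
  tauto

theorem opt_visit_append_trap_le (hc : 1 ≤ c) (hδ : 0 < δ) (hδ' : δ < 1 / 4) :
    opt c (⟨1, 1, δ⟩ :: trap δ δ).toFinset ≤ 1 + 2 * δ := by
  have h₁ := (canServe_empty c 0 0).visit (p := 0) (τ := δ + δ) (t := δ + δ) hc le_rfl
    (by norm_num; linarith)
  have h₂ := h₁.ride (r := ⟨1 / 2 + δ, 1, δ + 2 * δ⟩) (t₂ := 1 / 2 + 3 * δ) (t := 1 + 2 * δ) hc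
    (by dsimp only; linarith) (by rw [abs_le]; constructor <;> linarith)
    (by rw [abs_le]; constructor <;> linarith)
  have h₃ := h₂.visit (p := 1) (τ := δ) (t := 1 + 2 * δ) hc (by linarith) (by simp)
  have h₄ := h₃.visit (p := 1) (τ := δ + 1 + δ) (t := 1 + 2 * δ) hc (by linarith) (by simp)
  refine (opt_mono hc fun r hr => ?_).trans h₄.opt_le
  simp only [trap, List.mem_toFinset, List.mem_cons,
    List.not_mem_nil, Finset.mem_insert, Finset.notMem_empty, or_false] at hr ⊢
  tauto

theorem isRequestSequence_ride_append_trap (hδ : 0 < δ) (hδ' : δ < 1) (hδα : δ < α) :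
    IsRequestSequence (⟨δ, 1 / 2, δ⟩ :: ⟨1, 1, 2 * δ⟩ :: trap α δ) := by
  refine ⟨List.cons_ne_nil _ _, ?_, ?_⟩
  · simp only [trap, List.forall_mem_cons]
    exact ⟨by linarith, by linarith, by linarith, by linarith, by linarith, by simp⟩
  · simp only [trap, List.pairwise_cons, List.forall_mem_cons]
    refine ⟨⟨?_, ?_, ?_, ?_, ?_⟩, ⟨?_, ?_, ?_, ?_⟩, ⟨?_, ?_, ?_⟩, ⟨?_, ?_⟩, ?_, .nil⟩ <;>
      first | linarith | simp

theorem isRequestSequence_visit_append_trap (hδ : 0 < δ) (hδ' : δ < 1) :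
    IsRequestSequence (⟨1, 1, δ⟩ :: trap δ δ) := by
  refine ⟨List.cons_ne_nil _ _, ?_, ?_⟩
  · simp only [trap, List.forall_mem_cons]
    exact ⟨by linarith, by linarith, by linarith, by linarith, by simp⟩
  · simp only [trap, List.pairwise_cons, List.forall_mem_cons]
    refine ⟨⟨?_, ?_, ?_, ?_⟩, ⟨?_, ?_, ?_⟩, ⟨?_, ?_⟩, ?_, .nil⟩ <;> first | linarith | simp

theorem Late.init_ride_append_trap (hc : 1 ≤ c) (hα : 0 < α) (hα' : α < 1) (hδ : 0 < δ)
    (hδ' : δ < 1 / 4) (hδα : 4 * δ < α) (hαδ : α * (α + 1 + δ) < α + 1) :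
    Late tb α (α + 4 - 2 * δ) (.init (⟨δ, 1 / 2, δ⟩ :: ⟨1, 1, 2 * δ⟩ :: trap α δ)) := by
  set ride : Request := ⟨δ, 1 / 2, δ⟩ with hride
  set visit : Request := ⟨1, 1, 2 * δ⟩ with hvisit
  have hserve {t₀ : ℝ} (ht₀ : 0 ≤ t₀) : CanServe c {ride, visit} 0 t₀ 1 (t₀ + 1) :=
    canServe_ride_visit hc hδ.le (by linarith) (by linarith) (by linarith)
  have hmin {t₀ : ℝ} (s : Schedule) (hs : s.Serves c {ride, visit} 0 t₀) : t₀ + 1 ≤ s.finish := by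
    simpa [visit] using hs.add_abs_le_finish (r := visit) (by simp)
  have hopt₁ : 1 / 2 ≤ opt c {ride} := by
    simpa [ride] using abs_dst_le_opt hc (Finset.mem_singleton_self ride)
  have hopt₂ : opt c {ride, visit} = 1 := by
    linarith [(hserve le_rfl).opt_le, le_opt hc (hmin (t₀ := 0))]
  have hopt : opt c ([visit, ride] ++ trap α δ).toFinset ≤ α + 1 + δ :=
    (congrArg _ (List.toFinset_eq_of_perm _ _ (List.Perm.swap ride visit (trap α δ)))).trans_le
      (opt_ride_append_trap_le hc hα.le hδ hδ')
  obtain ⟨hs, hfin⟩ := tb.follow_serves_of_canServe [visit, ride] (hserve hα.le) hmin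
  obtain ⟨hend, hboard⟩ := hs.ride_to_one (by linarith) hfin
  refine Late.init_wait (early := [visit]) (future := trap α δ) hc hα.le
    (isRequestSequence_ride_append_trap hδ (by linarith) (by linarith)).2.2 ?_ ?_ ?_
  · have := mul_le_mul_of_nonneg_left hopt₁ hα.le
    simp only [List.forall_mem_cons, hride, hvisit] at this ⊢
    exact ⟨by linarith, by linarith, by simp⟩
  · simp only [trap, List.forall_mem_cons, List.toFinset_cons, List.toFinset_nil, insert_empty_eq,
      hopt₂]
    exact ⟨by linarith, by linarith, by linarith, by simp⟩
  simp only [List.toFinset_cons, List.toFinset_nil, insert_empty_eq, hopt₂, mul_one]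
  refine Late.starting_trap hc hα.le hδ hδ' hs hfin hend ?_
    (mul_le_mul_of_nonneg_left hopt hα.le) hαδ fun t ht ht' hret => ?_
  · simp only [Finset.mem_insert, Finset.mem_singleton, forall_eq_or_imp, forall_eq, ride, visit]
    exact ⟨by linarith, by linarith⟩
  · have hdeliver : t + |1 / 2 - (tb.follow [visit, ride] {ride, visit} 0 α).pos t| + |1 / 2| ≤
        α * (α + 1 + δ) :=
      hret.add_abs_add_abs_le (hboard t ht (by linarith))
    have hpos : (tb.follow [visit, ride] {ride, visit} 0 α).pos t - 0 ≤ t - α :=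
      le_of_abs_le (hs.1.abs_sub_le (by linarith))
    have hdst := le_abs_self (1 / 2 - (tb.follow [visit, ride] {ride, visit} 0 α).pos t)
    linarith

theorem Late.init_visit_append_trap (hc : 1 ≤ c) (hδ : 0 < δ) (hδ' : δ < 1 / 4) :
    Late tb 0 (4 - δ) (.init (⟨1, 1, δ⟩ :: trap δ δ)) := by
  have hserve : CanServe c {⟨1, 1, δ⟩} 0 δ 1 (δ + 1) :=
    (canServe_empty c 0 δ).visit hc (by linarith) (by simp)
  obtain ⟨hs, hfin⟩ := tb.follow_serves_of_canServe [⟨1, 1, δ⟩] hserve fun s hs => by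
    simpa using hs.add_abs_le_finish (Finset.mem_singleton_self _)
  refine Late.init_start (by simpa) ?_
  rw [show 4 - δ = δ + 4 - 2 * δ by ring]
  refine Late.starting_trap hc le_rfl hδ hδ' hs hfin ?_ (by simpa) (zero_mul _).le (by linarith)
    fun t ht _ hret => ?_
  · rw [← hfin]
    refine hs.pos_finish_eq_dst (Finset.mem_singleton_self _) ?_
    simpa [hfin] using hs.add_abs_le_unload (Finset.mem_singleton_self _)
  · linarith [hret.add_abs_le.trans' (le_add_of_nonneg_right (abs_nonneg _))]

theorem ofReal_le_lazyCompetitiveRatio_of_lt_one (hc : 1 ≤ c) (hα : 0 ≤ α) (hα' : α < 1) :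
    ENNReal.ofReal (1 + 3 / (α + 1)) ≤ lazyCompetitiveRatio tb α := by
  rcases hα.eq_or_lt with rfl | hα
  · convert ofReal_le_of_eventually_nhdsGT (f := fun δ => (4 - δ) / (1 + 2 * δ))
      (ContinuousAt.div (by fun_prop) (by fun_prop) (by norm_num)) ?_ using 2
    · norm_num
    filter_upwards [Ioo_mem_nhdsGT (show (0 : ℝ) < 1 / 4 by norm_num)] with δ hδ
    exact ofReal_div_le_lazyCompetitiveRatio
      (isRequestSequence_visit_append_trap hδ.1 (by linarith [hδ.2]))
      (Late.init_visit_append_trap hc hδ.1 hδ.2) (by linarith [hδ.1])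
      (opt_visit_append_trap_le hc hδ.1 hδ.2)
  · convert ofReal_le_of_eventually_nhdsGT (f := fun δ => (α + 4 - 2 * δ) / (α + 1 + δ))
      (ContinuousAt.div (by fun_prop) (by fun_prop) (by linarith)) ?_ using 2
    · field_simp
      ring
    have hmin : 0 < min (1 / 4) (min (α / 4) (1 - α)) := by
      simp only [lt_min_iff, sub_pos, hα']
      exact ⟨by norm_num, by linarith, trivial⟩
    filter_upwards [Ioo_mem_nhdsGT hmin] with δ ⟨hδ, hδ'⟩
    simp only [lt_min_iff] at hδ'
    obtain ⟨hδ', hδα, hαδ⟩ := hδ'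
    exact ofReal_div_le_lazyCompetitiveRatio
      (isRequestSequence_ride_append_trap hδ (by linarith) (by linarith))
      (Late.init_ride_append_trap hc hα hα' hδ hδ' (by linarith) (by nlinarith)) (by linarith)
      (opt_ride_append_trap_le hc hα.le hδ hδ')

end SmallAlpha

section LargeAlpha

variable {s : Schedule} {R : Finset Request} {g δ t₀ τ τ' F : ℝ}

theorem abs_mul_sub_mul (hg : |g| = 1) (a b : ℝ) : |g * a - g * b| = |a - b| := by
  rw [← mul_sub, abs_mul, hg, one_mul]

/-- A request that has to be carried away from the origin, to `g = ±1`. Its source lies a bit off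
the origin, on the same side, so that a server which has just left the origin for `g` has it on
board. -/
noncomputable def outward (g δ τ : ℝ) : Request := ⟨g * δ, g, τ⟩

theorem Schedule.Serves.add_three_le_finish_of_outward (hg : |g| = 1) (hδ : δ < 1)
    (hs : s.Serves c R 0 t₀) (hr : outward g δ τ ∈ R) (hr' : outward (-g) δ τ' ∈ R)
    (hle : s.unload (outward g δ τ) ≤ s.unload (outward (-g) δ τ')) :
    t₀ + 3 ≤ s.finish ∧ (s.finish ≤ t₀ + 3 → s.pos s.finish = -g ∧
      ∀ t, t₀ + δ ≤ t → t < t₀ + 1 → outward g δ τ ∈ s.onBoard R t) := by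
  have hfirst : t₀ + 1 ≤ s.unload (outward g δ τ) := by
    simpa [outward, hg] using hs.add_abs_le_unload hr
  have hsecond : s.unload (outward g δ τ) + 2 ≤ s.unload (outward (-g) δ τ') := by
    have hdist : |-g - g| = 2 := by
      have := abs_mul_sub_mul hg (-1) 1
      norm_num at this
      exact this
    simpa only [outward, hdist] using hs.unload_add_abs_le_unload hr hr' hle
  have hfinish := hs.unload_le_finish hr'
  refine ⟨by linarith, fun hfin => ⟨hs.pos_finish_eq_dst hr' (by linarith), fun t ht ht' => ?_⟩⟩
  have hload : s.load (outward g δ τ) + (1 - δ) ≤ s.unload (outward g δ τ) := by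
    have hdist : |g - g * δ| = 1 - δ := by
      simpa [abs_of_pos (sub_pos.2 hδ)] using abs_mul_sub_mul hg 1 δ
    simpa only [outward, hdist] using hs.load_add_abs_le_unload hr hr (hs.load_le_unload hr)
  exact mem_onBoard.2 ⟨hr, by linarith, by linarith⟩

theorem Schedule.Serves.add_three_le_finish_of_outward_pair (hδ : δ < 1)
    (hs : s.Serves c {outward 1 δ τ, outward (-1) δ τ'} 0 t₀) :
    t₀ + 3 ≤ s.finish ∧ (s.finish ≤ t₀ + 3 → ∃ g, |g| = 1 ∧ s.pos s.finish = -g ∧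
      ∀ t, t₀ + δ ≤ t → t < t₀ + 1 →
        ∃ r ∈ s.onBoard {outward 1 δ τ, outward (-1) δ τ'} t, r.dst = g) := by
  rcases le_total (s.unload (outward 1 δ τ)) (s.unload (outward (-1) δ τ')) with hle | hle
  · obtain ⟨hfin, hend⟩ := hs.add_three_le_finish_of_outward abs_one hδ (by simp) (by simp) hle
    exact ⟨hfin, fun h => ⟨1, abs_one, (hend h).1, fun t ht ht' => ⟨_, (hend h).2 t ht ht', rfl⟩⟩⟩
  · obtain ⟨hfin, hend⟩ := hs.add_three_le_finish_of_outward (g := -1) (τ := τ') (τ' := τ) (by simp)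
      hδ (by simp) (by simp) (by simpa using hle)
    exact ⟨hfin, fun h => ⟨-1, by simp, (hend h).1, fun t ht ht' => ⟨_, (hend h).2 t ht ht', rfl⟩⟩⟩

theorem canServe_outward (hc : 1 ≤ c) (hg : |g| = 1) (hδ : 0 ≤ δ) (hδ' : δ ≤ 1)
    (hτ : τ ≤ t₀ + δ) (hτ' : τ' ≤ t₀ + δ) :
    CanServe c {outward (-g) δ τ', outward g δ τ} 0 t₀ (-g) (t₀ + 3) := by
  have hdist (a b : ℝ) {d : ℝ} (h : |a - b| ≤ d) : |g * a - g * b| ≤ d :=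
    (abs_mul_sub_mul hg a b).trans_le h
  have hfirst : CanServe c {outward g δ τ} 0 t₀ g (t₀ + 1) := by
    refine (canServe_empty c 0 t₀).ride (r := outward g δ τ) (t₂ := t₀ + δ) hc hτ ?_ ?_
    · simpa [outward] using hdist δ 0 (by simp [abs_of_nonneg hδ])
    · simpa [outward] using hdist 1 δ (abs_of_nonneg (sub_nonneg.2 hδ') |>.trans_le (by linarith))
  refine hfirst.ride (r := outward (-g) δ τ') (t₂ := t₀ + 2 + δ) hc (hτ'.trans (by linarith)) ?_ ?_
  · simpa [outward] using hdist (-δ) 1 (by rw [abs_of_nonpos] <;> linarith)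
  · simpa [outward] using hdist (-1) (-δ) (by rw [abs_of_nonpos] <;> linarith)

theorem canServe_outward_pair (hc : 1 ≤ c) (hg : |g| = 1) (hδ : 0 ≤ δ) (hδ' : δ ≤ 1)
    (hτ : τ ≤ t₀ + δ) (hτ' : τ' ≤ t₀ + δ) :
    CanServe c {outward 1 δ τ, outward (-1) δ τ'} 0 t₀ g (t₀ + 3) := by
  rcases eq_or_eq_neg_of_abs_eq hg with rfl | rfl
  · simpa using canServe_outward (g := -1) hc (by simp) hδ hδ' hτ' hτ
  · simpa only [Finset.pair_comm] using canServe_outward hc abs_one hδ hδ' hτ hτ'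

theorem opt_outward_pair (hc : 1 ≤ c) (hδ : 0 ≤ δ) (hδ' : δ < 1) (hτ : τ ≤ δ) (hτ' : τ' ≤ δ) :
    opt c {outward 1 δ τ, outward (-1) δ τ'} = 3 := by
  refine le_antisymm ?_ (le_opt hc fun s hs => ?_)
  · simpa using (canServe_outward_pair (t₀ := 0) hc abs_one hδ hδ'.le (by simpa) (by simpa)).opt_le
  · simpa using (hs.add_three_le_finish_of_outward_pair hδ').1

/-- The requests of the second lower bound for `α ≥ 1`: the last one extends the ride that an
offline server finishes in `g` at time `3`. -/
noncomputable def outwardThenVisit (g δ F : ℝ) : List Request :=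
  [outward 1 δ (δ / 2), outward (-1) δ δ, ⟨g * (F - 2), g * (F - 2), F⟩]

theorem isRequestSequence_outwardThenVisit (hδ : 0 < δ) (hF : δ < F) :
    IsRequestSequence (outwardThenVisit g δ F) := by
  refine ⟨List.cons_ne_nil _ _, ?_, ?_⟩
  · simp only [outwardThenVisit, outward, List.forall_mem_cons]
    exact ⟨by linarith, hδ, by linarith, by simp⟩
  · simp only [outwardThenVisit, outward, List.pairwise_cons, List.forall_mem_cons]
    exact ⟨⟨by linarith, by linarith, by simp⟩, ⟨hF, by simp⟩, by simp, .nil⟩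

theorem opt_outwardThenVisit_le (hc : 1 ≤ c) (hg : |g| = 1) (hδ : 0 ≤ δ) (hδ' : δ ≤ 1)
    (hF : 3 ≤ F) : opt c (outwardThenVisit g δ F).toFinset ≤ F := by
  have hpair : CanServe c {outward 1 δ (δ / 2), outward (-1) δ δ} 0 0 g 3 := by
    simpa using canServe_outward_pair (t₀ := 0) hc hg hδ hδ' (by linarith) (by linarith)
  have hdist : |g * (F - 2) - g| = F - 3 := by
    have := abs_mul_sub_mul hg (F - 2) 1
    rw [mul_one, abs_of_nonneg (a := F - 2 - 1) (by linarith)] at this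
    linarith
  have hvisit := hpair.visit (p := g * (F - 2)) (τ := F) (t := F) hc le_rfl hdist.le
  refine (opt_mono hc fun r hr => ?_).trans hvisit.opt_le
  simp only [outwardThenVisit, List.mem_toFinset, List.mem_cons, List.not_mem_nil, or_false,
    Finset.mem_insert, Finset.mem_singleton] at hr ⊢
  tauto

theorem Late.starting_outward_pair_visit {h : List Request} (hc : 1 ≤ c) (hα : 0 ≤ α) (hg : |g| = 1)
    (hF : 3 ≤ F) (hs : (tb.follow h R 0 t₀).Serves c R 0 t₀)
    (hfin : (tb.follow h R 0 t₀).finish = t₀ + 3)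
    (hend : (tb.follow h R 0 t₀).pos (t₀ + 3) = -g)
    (hboard : ∃ r ∈ (tb.follow h R 0 t₀).onBoard R F, r.dst = g)
    (hrel : ∀ r ∈ R, r.release < F) (ht₀ : t₀ ≤ F) (hF' : F ≤ t₀ + 3)
    (hopt : α * opt c (⟨g * (F - 2), g * (F - 2), F⟩ :: h).toFinset ≤ α * F)
    (hαF : α * F < t₀ + 2) :
    Late tb α (t₀ + 2 + F) (.starting tb h R 0 t₀ [⟨g * (F - 2), g * (F - 2), F⟩]) := by
  refine Late.starting_append (new := [⟨g * (F - 2), g * (F - 2), F⟩]) (future := [])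
    hc hα hs (List.cons_ne_nil _ _) ?_ (by simp) hopt (by linarith) ?_ ?_
  · simp only [List.forall_mem_singleton, hfin]
    exact ⟨fun hr => (hrel _ hr).false, hF'⟩
  · simp only [List.forall_mem_singleton]
    intro hret
    obtain ⟨r, hr, rfl⟩ := hboard
    have hdeliver := hret.add_abs_add_abs_le hr
    have hpos := hs.1.abs_sub_le ht₀
    have hdst := abs_sub_abs_le_abs_sub r.dst ((tb.follow h R 0 t₀).pos F)
    rw [sub_zero] at hpos
    linarith
  rw [hfin, hend]
  refine Late.starting_visit hc hF' ?_
  have hdist : |g * (F - 2) - -g| = F - 1 := by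
    have := abs_mul_sub_mul hg (F - 2) (-1)
    rw [mul_neg_one, abs_of_nonneg (a := F - 2 - -1) (by linarith)] at this
    linarith
  linarith

theorem Late.init_outwardThenVisit (hc : 1 ≤ c) (hα : 1 ≤ α) (hδ : 0 < δ) (hδ' : δ < 1)
    (hαδ : α * (3 * α + δ) < 3 * α + 2) :
    ∃ g, |g| = 1 ∧ Late tb α (6 * α + 2 + δ) (.init (outwardThenVisit g δ (3 * α + δ))) := by
  set R : Finset Request := {outward 1 δ (δ / 2), outward (-1) δ δ}
  set h : List Request := [outward (-1) δ δ, outward 1 δ (δ / 2)]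
  have hopt₁ : 1 ≤ opt c {outward 1 δ (δ / 2)} := by
    simpa [outward] using abs_dst_le_opt hc (Finset.mem_singleton_self (outward 1 δ (δ / 2)))
  have hopt₂ : α * opt c R = 3 * α := by
    rw [opt_outward_pair hc hδ.le hδ' (by linarith) le_rfl, mul_comm]
  have hserve : CanServe c R 0 (3 * α) 1 (3 * α + 3) :=
    canServe_outward_pair hc abs_one hδ.le hδ'.le (by linarith) (by linarith)
  obtain ⟨hs, hfin⟩ := tb.follow_serves_of_canServe h hserve fun s hs =>
    (hs.add_three_le_finish_of_outward_pair hδ').1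
  obtain ⟨g, hg, hend, hboard⟩ := (hs.add_three_le_finish_of_outward_pair hδ').2 hfin.le
  have hopt₃ := opt_outwardThenVisit_le (F := 3 * α + δ) hc hg hδ.le hδ'.le (by linarith)
  have hseq := isRequestSequence_outwardThenVisit (g := g) hδ (F := 3 * α + δ) (by linarith)
  refine ⟨g, hg, Late.init_wait (early := [outward (-1) δ δ]) hc (by linarith) hseq.2.2 ?_ ?_ ?_⟩
  · simp only [List.forall_mem_cons, outward] at hopt₁ ⊢
    exact ⟨by nlinarith, by nlinarith, by simp⟩
  · simp only [List.toFinset_cons, List.toFinset_nil, insert_empty_eq, List.forall_mem_singleton]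
    exact hopt₂.trans_lt (by linarith)
  simp only [List.toFinset_cons, List.toFinset_nil, insert_empty_eq]
  rw [show α * opt c {outward 1 δ (δ / 2), outward (-1) δ δ} = 3 * α from hopt₂,
    show 6 * α + 2 + δ = 3 * α + 2 + (3 * α + δ) by ring]
  refine Late.starting_outward_pair_visit hc (by linarith) hg (by linarith) hs hfin
    (hfin ▸ hend) (hboard _ le_rfl (by linarith)) ?_ (by linarith) (by linarith) ?_ hαδ
  · simp only [outward, Finset.mem_insert, Finset.mem_singleton, forall_eq_or_imp, forall_eq]
    exact ⟨by linarith, by linarith⟩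
  · refine mul_le_mul_of_nonneg_left ((opt_mono hc fun r hr => ?_).trans hopt₃) (by linarith)
    simp only [outwardThenVisit, List.mem_toFinset, List.mem_cons, List.mem_reverse,
      List.not_mem_nil, or_false] at hr ⊢
    tauto

theorem ofReal_max_le_lazyCompetitiveRatio_of_one_le (hc : 1 ≤ c) (hα : 1 ≤ α) :
    ENNReal.ofReal (max (1 + α) (2 + 2 / (3 * α))) ≤ lazyCompetitiveRatio tb α := by
  rcases le_or_gt (2 + 2 / (3 * α)) (1 + α) with hle | hlt
  · rw [max_eq_left hle]
    exact ofReal_one_add_le_lazyCompetitiveRatio hc (one_pos.trans_le hα)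
  have hα₂ : 3 * α ^ 2 < 3 * α + 2 := by
    have : (α - 1) * (3 * α) < 2 := (lt_div_iff₀ (by linarith)).1 (by linarith)
    linarith
  rw [max_eq_right hlt.le]
  convert ofReal_le_of_eventually_nhdsGT (f := fun δ => (6 * α + 2 + δ) / (3 * α + δ))
    (ContinuousAt.div (by fun_prop) (by fun_prop) (by linarith)) ?_ using 2
  · have hα₀ : α ≠ 0 := by linarith
    field_simp
    ring
  have hmin : 0 < min 1 ((3 * α + 2 - 3 * α ^ 2) / α) :=
    lt_min one_pos (div_pos (by linarith) (by linarith))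
  filter_upwards [Ioo_mem_nhdsGT hmin] with δ ⟨hδ, hδ'⟩
  obtain ⟨hδ', hαδ⟩ := lt_min_iff.1 hδ'
  rw [lt_div_iff₀ (by linarith)] at hαδ
  obtain ⟨g, hg, hL⟩ := Late.init_outwardThenVisit hc hα hδ hδ' (by linarith)
  exact ofReal_div_le_lazyCompetitiveRatio
    (isRequestSequence_outwardThenVisit hδ (by linarith)) hL (by linarith)
    (opt_outwardThenVisit_le hc hg hδ.le hδ'.le (by linarith))

end LargeAlpha

theorem three_halves_add_sqrt_le_max (hα : 0 < α) :
    3 / 2 + √(11 / 12) ≤ max (1 + α) (2 + 2 / (3 * α)) := by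
  have hsq : √(11 / 12 : ℝ) ^ 2 = 11 / 12 := Real.sq_sqrt (by norm_num)
  rcases le_total (1 / 2 + √(11 / 12)) α with hle | hle
  · exact le_max_of_le_left (by linarith)
  · refine le_max_of_le_right ?_
    have hhalf : 1 / 2 ≤ √(11 / 12 : ℝ) := Real.le_sqrt_of_sq_le (by norm_num)
    have hdiv : √(11 / 12) - 1 / 2 ≤ 2 / (3 * α) := by
      rw [le_div_iff₀ (by linarith)]
      calc (√(11 / 12) - 1 / 2) * (3 * α)
          ≤ (√(11 / 12) - 1 / 2) * (3 * (1 / 2 + √(11 / 12))) := by gcongr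
        _ = 2 := by linarith
    linarith

theorem three_halves_add_sqrt_le_of_lt_one (hα : 0 ≤ α) (hα' : α < 1) :
    3 / 2 + √(11 / 12) ≤ 1 + 3 / (α + 1) := by
  have hsqrt : √(11 / 12 : ℝ) ≤ 1 := Real.sqrt_le_one.2 (by norm_num)
  have hdiv : 3 / 2 ≤ 3 / (α + 1) := by gcongr; linarith
  linarith

end DialARide

theorem corollary1 (c : ℕ∞) (hc : 1 ≤ c) (α : ℝ) (hα : 0 ≤ α) (tb : DialARide.TieBreaking c) :
    ENNReal.ofReal (3 / 2 + √(11 / 12)) ≤ DialARide.lazyCompetitiveRatio tb α ∧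
    (1 ≤ α →
      ENNReal.ofReal (max (1 + α) (2 + 2 / (3 * α))) ≤ DialARide.lazyCompetitiveRatio tb α) ∧
    (α < 1 →
      ENNReal.ofReal (1 + 3 / (α + 1)) ≤ DialARide.lazyCompetitiveRatio tb α) := by
  have hlarge (h : 1 ≤ α) :=
    DialARide.ofReal_max_le_lazyCompetitiveRatio_of_one_le (tb := tb) hc h
  have hsmall (h : α < 1) :=
    DialARide.ofReal_le_lazyCompetitiveRatio_of_lt_one (tb := tb) hc hα h
  refine ⟨?_, hlarge, hsmall⟩
  rcases le_or_gt 1 α with h | h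
  · exact (ENNReal.ofReal_le_ofReal
      (DialARide.three_halves_add_sqrt_le_max (one_pos.trans_le h))).trans (hlarge h)
  · exact (ENNReal.ofReal_le_ofReal
      (DialARide.three_halves_add_sqrt_le_of_lt_one hα h)).trans (hsmall h)
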